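/- Fix a first-order constraint theory $T$. A constrained Horn clause is $H\leftarrow\mathcal C,B_1,\dots,B_r$ with $\mathcal C$ a constraint (a formula in the language of $T$) and $H,B_1,\dots,B_r$ atoms $p(X)$; a set of clauses is linear if every clause has at most one body atom. $Q\models A$ denotes logical consequence modulo $T$: $A$ is true in every interpretation, over a model of $T$, that makes every clause of $Q$ true. Let $P$ be a set of constrained Horn clauses, $\mathit{false}$ a $0$-ary predicate symbol, and $k\ge 0$. The $k$-dimension-bounded program $P^{\le k}$ over the predicate symbols $p^{=d},p^{\le d}$ (with $p$ a predicate symbol of $P$) consists of the following clauses: (1) $H^{=0}\leftarrow\mathcal C$ for each $H\leftarrow\mathcal C$ in $P$; and $H^{=d}\leftarrow\mathcal C,B_1^{=d}$ for each $H\leftarrow\mathcal C,B_1$ in $P$ and $0\le d\le k$; (2) for each $H\leftarrow\mathcal C,B_1,\dots,B_r$ in $P$ with $r>1$ and each $1\le d\le k$: (a) for each $1\le j\le r$, the clause $H^{=d}\leftarrow\mathcal C,Z_1,\dots,Z_r$ with $Z_j=B_j^{=d}$ and $Z_i=B_i^{\le d-1}$ for $i\ne j$; (b) if $d\ge 2$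 or $r=2$, for each $J\subseteq\{1,\dots,r\}$ with $|J|=2$, the clause $H^{=d}\leftarrow\mathcal C,Z_1,\dots,Z_r$ with $Z_i=B_i^{=d-1}$ for $i\in J$ and $Z_i=B_i^{\le d-1}$ for $i\notin J$; (3) $p^{\le d}(X)\leftarrow p^{=e}(X)$ for each $p$ and $0\le e\le d\le k$. Consider the interpreter \begin{align*} &\mathtt{go(Index)\ {:}{-}\ solve([false],Index,1).}\\ &\mathtt{solve([G|Gs],Index,L)\ {:}{-}\ hornClause(G,Cs,B),\ solveConstraints(Cs),\ length(B,L1),}\\ &\qquad\mathtt{L2\ is\ L1+L-1,\ L2\ {=}{<}\ Index,\ perm(B,B1),\ append(B1,Gs,Gs1),\ solve(Gs1,Index,L2).}\\ &\mathtt{solve([\,],\_,\_).} \end{align*} where the facts $\mathtt{hornClause(G,Cs,B)}$ represent the clauses $G\leftarrow Cs,B$ of $P^{\le k}$ and $\mathtt{false}$ stands for the top-level predicate $\mathit{false}^{\le k}$. Assume that the maximum $i$ of the numbers of body atoms of the clauses of $P$ exists, and that $i\ge 1$ or $k=0$. Let $\mathtt{Index}=(i-1)\cdot k+1$. Let $P'$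 be the partial evaluation of this interpreter with respect to $P^{\le k}$ and the call $\mathtt{go(Index)}$, in which all calls are evaluated except the calls to $\mathtt{solve}$ and the execution of the constraints. That is, for each reachable call pattern $\mathtt{solve}([p_1(Y_1),\dots,p_n(Y_n)],\mathtt{Index},l)$ (fixed $p_1,\dots,p_n$, $\mathtt{Index}$, $l$; the $Y_j$ tuples of distinct variables), $P'$ has a new predicate symbol with arguments $Y_1,\dots,Y_n$. Its clauses are the results of unfolding the call with each interpreter clause, each object clause for $p_1$ and each permutation of its body that passes the size check. The remaining $\mathtt{solve}$ call is replaced by an atom with the corresponding new predicate symbol, and the constraint $Cs$ is inlined. The clause for $\mathtt{go(Index)}$ calls the pattern $\mathtt{solve([false],Index,1)}$. Then $P^{\le k}\models\mathit{false}^{\le k}$ if and only if $P'\models\mathtt{go(Index)}$. Moreover, $P'$ is linear. -/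

import Mathlib

universe u v w

namespace CHC

/-! ### Constrained Horn clauses and logical consequence -/

/-- An atom `p(x₁, …, xₙ)`: a predicate symbol of arity `n` applied to variables from `V`. -/
structure Atom {Pred : Type w} (ar : Pred → ℕ) (V : Type) : Type w where
  pred : Pred
  args : Fin (ar pred) → V

/-- Renaming of the variables of an atom. -/
def Atom.rename {Pred : Type w} {ar : Pred → ℕ} {V W : Type} (f : V → W) (A : Atom ar V) :
    Atom ar W :=
  ⟨A.pred, f ∘ A.args⟩

/-- The atom consisting of a predicate symbol without arguments. -/
def Atom.prop {Pred : Type w} {ar : Pred → ℕ} {V : Type} (p : Pred) (h : ar p = 0) : Atom ar V :=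
  ⟨p, fun j => (Fin.cast h j).elim0⟩

/-- A constrained Horn clause `head ← constr, body`. The constraint is a formula of the first-order
language `L` of the constraint theory, `body` is the list of the non-constraint atoms. -/
structure Clause (L : FirstOrder.Language.{u, v}) {Pred : Type w} (ar : Pred → ℕ) (V : Type) :
    Type (max u v w) where
  head : Atom ar V
  constr : L.Formula V
  body : List (Atom ar V)

/-- A set of clauses is linear if every clause has at most one atom in its body. -/
def IsLinear {L : FirstOrder.Language.{u, v}} {Pred : Type w} {ar : Pred → ℕ} {V : Type}
    (P : Set (Clause L ar V)) : Prop :=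
  ∀ c ∈ P, c.body.length ≤ 1

/-- An interpretation of the predicate symbols over the domain `M`. -/
abbrev Interp {Pred : Type w} (ar : Pred → ℕ) (M : Type*) := ∀ p : Pred, (Fin (ar p) → M) → Prop

/-- Truth of an atom under an interpretation and a valuation of the variables. -/
def Atom.Holds {Pred : Type w} {ar : Pred → ℕ} {V : Type} {M : Type*} (I : Interp ar M)
    (val : V → M) (A : Atom ar V) : Prop :=
  I A.pred (val ∘ A.args)

/-- Truth of a clause (all its variables being universally quantified) in an interpretation. -/
def Clause.TrueIn {L : FirstOrder.Language.{u, v}} {Pred : Type w} {ar : Pred → ℕ} {V : Type} {M : Type*}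
    [L.Structure M] (I : Interp ar M) (c : Clause L ar V) : Prop :=
  ∀ val : V → M, c.constr.Realize val → (∀ B ∈ c.body, B.Holds I val) → c.head.Holds I val

/-- Logical consequence `P ⊨ A` modulo the constraint theory `T`: in every model `M` of `T`, every
interpretation of the predicate symbols over `M` that makes all clauses of `P` true
makes (the universal closure of) `A` true. -/
def Entails {L : FirstOrder.Language.{u, v}} (T : L.Theory) {Pred : Type w} {ar : Pred → ℕ} {V : Type}
    (P : Set (Clause L ar V)) (A : Atom ar V) : Prop :=
  ∀ (M : FirstOrder.Language.Theory.ModelType.{u, v, max u v w} T) (I : Interp ar M),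
    (∀ c ∈ P, c.TrueIn I) → ∀ val : V → M, A.Holds I val

/-! ### The at-most-`k`-dimension program -/

/-- The superscripts `=d` and `≤d` of the split predicate symbols. -/
inductive DimTag : Type
  | exactly (d : ℕ)
  | atMost (d : ℕ)

/-- A split predicate symbol `(p, tag)` has the arity of `p`. -/
def dimArity {Pred : Type w} (ar : Pred → ℕ) (q : Pred × DimTag) : ℕ := ar q.1

/-- The atom `A^{=d}` or `A^{≤d}`. -/
def Atom.tag {Pred : Type w} {ar : Pred → ℕ} {V : Type} (A : Atom ar V) (t : DimTag) :
    Atom (dimArity ar) V :=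
  ⟨(A.pred, t), A.args⟩

/-- The clause `H^{=d} ← C, B₁^{z₁}, …, Bᵣ^{zᵣ}` obtained from `H ← C, B₁, …, Bᵣ`. -/
def Clause.annotate {L : FirstOrder.Language.{u, v}} {Pred : Type w} {ar : Pred → ℕ} {V : Type}
    (c : Clause L ar V) (d : ℕ) (z : Fin c.body.length → DimTag) :
    Clause L (dimArity ar) V where
  head := c.head.tag (.exactly d)
  constr := c.constr
  body := List.ofFn fun j => (c.body.get j).tag (z j)

/-- The clause `p^{≤d}(X) ← p^{=e}(X)`, where `X` is a vector of distinct variables. -/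
def epsClause (L : FirstOrder.Language.{u, v}) {Pred : Type w} (ar : Pred → ℕ) (p : Pred) (d e : ℕ) :
    Clause L (dimArity ar) ℕ where
  head := ⟨(p, .atMost d), fun j => (j : ℕ)⟩
  constr := ⊤
  body := [⟨(p, .exactly e), fun j => (j : ℕ)⟩]

/-- `BoundedClause P k c`: the clause `c` belongs to the at-most-`k`-dimension program of `P`. -/
inductive BoundedClause {L : FirstOrder.Language.{u, v}} {Pred : Type w} {ar : Pred → ℕ}
    (P : Set (Clause L ar ℕ)) (k : ℕ) : Clause L (dimArity ar) ℕ → Prop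
  /-- `H^{=0} ← C`. -/
  | fact (c : Clause L ar ℕ) (hc : c ∈ P) (hr : c.body.length = 0)
      (z : Fin c.body.length → DimTag) :
      BoundedClause P k (c.annotate 0 z)
  /-- `H^{=d} ← C, B₁^{=d}`. -/
  | linear (c : Clause L ar ℕ) (hc : c ∈ P) (hr : c.body.length = 1) (d : ℕ) (hd : d ≤ k) :
      BoundedClause P k (c.annotate d fun _ => .exactly d)
  /-- One body atom has superscript `=d`, all others have `≤d-1`. -/
  | oneMax (c : Clause L ar ℕ) (hc : c ∈ P) (hr : 1 < c.body.length) (d : ℕ) (hd : 1 ≤ d)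
      (hdk : d ≤ k) (j : Fin c.body.length) :
      BoundedClause P k (c.annotate d fun i => if i = j then .exactly d else .atMost (d - 1))
  /-- Two body atoms have superscript `=d-1`, all others have `≤d-1`. -/
  | twoMax (c : Clause L ar ℕ) (hc : c ∈ P) (hr : 1 < c.body.length) (d : ℕ) (hd : 1 ≤ d)
      (hdk : d ≤ k) (J : Finset (Fin c.body.length)) (hJ : J.card = 2)
      (hdef : 2 < c.body.length → 2 ≤ d) :
      BoundedClause P k
        (c.annotate d fun i => if i ∈ J then .exactly (d - 1) else .atMost (d - 1))
  /-- `p^{≤d}(X) ← p^{=e}(X)`. -/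
  | eps (p : Pred) (d e : ℕ) (hdk : d ≤ k) (hed : e ≤ d) :
      BoundedClause P k (epsClause L ar p d e)

/-- The at-most-`k`-dimension program `P^{≤k}`. -/
def boundedProgram {L : FirstOrder.Language.{u, v}} {Pred : Type w} {ar : Pred → ℕ}
    (P : Set (Clause L ar ℕ)) (k : ℕ) : Set (Clause L (dimArity ar) ℕ) :=
  {c | BoundedClause P k c}

/-! ### The interpreter

```
go(Index) :- solve([false], Index, 1).
solve([G|Gs], Index, L) :-
  hornClause(G, Cs, B), solveConstraints(Cs),
  length(B, L1), L2 is L1 + L - 1, L2 =< Index,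
  perm(B, B1), append(B1, Gs, Gs1),
  solve(Gs1, Index, L2).
solve([], _, _).
```
-/

/-- The second clause of the interpreter with its calls to `hornClause`, `length`, `is`, `=<`,
`perm` and `append` executed: the call `solve(Gs₀, Index, L)` reduces to the residual goal
`solveConstraints(Cs), solve(Gs1, Index, L2)`.
The types `A` of the atoms and `K` of the constraints are arbitrary. -/
inductive SolveStep {A : Type*} {K : Type*} (hornClause : A → K → List A → Prop) (Index : ℤ) :
    List A → ℤ → K → List A → ℤ → Prop
  | intro (G : A) (Gs : List A) (L : ℤ) (Cs : K) (B B1 Gs1 : List A) (L1 L2 : ℤ)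
      (hclause : hornClause G Cs B)
      (hlength : L1 = (B.length : ℤ)) (his : L2 = L1 + L - 1) (hle : L2 ≤ Index)
      (hperm : B.Perm B1) (happend : Gs1 = B1 ++ Gs) :
      SolveStep hornClause Index (G :: Gs) L Cs Gs1 L2

/-! ### Partial evaluation of the interpreter

The arguments `Index`, `L` of `solve` and the list of the predicate symbols of the atoms in `Gs` are
static, the arguments of these atoms are dynamic. Hence the specialised versions of
`solve` are indexed by a list of predicate symbols and the values of `Index` and `L`; the
arguments of a specialised version are all arguments of all atoms in `Gs`, in order. -/

/-- The predicate symbols of the residual program. -/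
inductive ResPred (Pred : Type w) : Type w
  /-- The specialisation of `go(Index)`. -/
  | go (Index : ℤ)
  /-- The specialisation of `solve([p₁(..), …, pₙ(..)], Index, L)`. -/
  | solve (ps : List Pred) (Index L : ℤ)

/-- The arities of the residual predicate symbols. -/
def resArity {Pred : Type w} (ar : Pred → ℕ) : ResPred Pred → ℕ
  | .go _ => 0
  | .solve ps _ _ => (ps.map ar).sum

/-- Structure flattening: the concatenation of the argument tuples of a list of atoms. -/
def flatten {Pred : Type w} {ar : Pred → ℕ} {V : Type} :
    (Gs : List (Atom ar V)) → Fin (((Gs.map Atom.pred).map ar).sum) → V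
  | [] => Fin.elim0
  | G :: Gs => Fin.append G.args (flatten Gs)

/-- The call `solve(Gs, Index, L)` after structure flattening and predicate renaming. -/
def solveAtom {Pred : Type w} {ar : Pred → ℕ} {V : Type} (Gs : List (Atom ar V)) (Index L : ℤ) :
    Atom (resArity ar) V :=
  ⟨.solve (Gs.map Atom.pred) Index L, flatten Gs⟩

/-- The variables of a residual clause: `.inl x` is the variable `x` of the object clause that was
selected, `.inr (i, j)` is the `j`-th argument of the `i`-th of the remaining goal atoms. -/
abbrev ResVar : Type := ℕ ⊕ (ℕ × ℕ)

/-- Atoms with the given predicate symbols applied to pairwise distinct variables, none of which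
occurs in the renamed object clause. -/
def freshAtoms {Pred : Type w} (ar : Pred → ℕ) (ps : List Pred) : List (Atom ar ResVar) :=
  ps.mapIdx fun i p => ⟨p, fun j => .inr (i, (j : ℕ))⟩

/-- The facts `hornClause(G, Cs, B)` that represent the object program `Q`, with the variables
renamed apart from those of `freshAtoms`. -/
def HornClauseFact {L : FirstOrder.Language.{u, v}} {Pred : Type w} {ar : Pred → ℕ}
    (Q : Set (Clause L ar ℕ)) (G : Atom ar ResVar) (Cs : L.Formula ResVar)
    (B : List (Atom ar ResVar)) : Prop :=
  ∃ c ∈ Q, G = c.head.rename Sum.inl ∧ Cs = c.constr.relabel Sum.inl ∧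
    B = c.body.map (Atom.rename Sum.inl)

/-- `Resultant Q Index p ps l G Cs Gs1 l2`: unfolding the most general call
`solve([p(X), p₁(Y₁), …, pₙ(Yₙ)], Index, l)`, where `ps` is `p₁, …, pₙ`, with a clause for `p` gives
`solve([G, p₁(Y₁), …, pₙ(Yₙ)], Index, l) :- solveConstraints(Cs), solve(Gs1, Index, l2)`,
where `G` is the head of the (renamed) clause, hence the most general common instance of `p(X)`
and that head. -/
def Resultant {L : FirstOrder.Language.{u, v}} {Pred : Type w} {ar : Pred → ℕ}
    (Q : Set (Clause L ar ℕ)) (Index : ℤ) (p : Pred) (ps : List Pred) (l : ℤ)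
    (G : Atom ar ResVar) (Cs : L.Formula ResVar) (Gs1 : List (Atom ar ResVar)) (l2 : ℤ) : Prop :=
  G.pred = p ∧ SolveStep (HornClauseFact Q) Index (G :: freshAtoms ar ps) l Cs Gs1 l2

/-- The call patterns of `solve` that occur in the partial evaluation with respect to `go(Index)`,
where `goal` is the predicate symbol of `Q` that plays the role of `false`. -/
inductive Called {L : FirstOrder.Language.{u, v}} {Pred : Type w} {ar : Pred → ℕ}
    (Q : Set (Clause L ar ℕ)) (goal : Pred) (Index : ℤ) : List Pred → ℤ → Prop
  | init : Called Q goal Index [goal] 1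
  | step (p : Pred) (ps : List Pred) (l : ℤ) (G : Atom ar ResVar) (Cs : L.Formula ResVar)
      (Gs1 : List (Atom ar ResVar)) (l2 : ℤ)
      (hcall : Called Q goal Index (p :: ps) l)
      (hres : Resultant Q Index p ps l G Cs Gs1 l2) :
      Called Q goal Index (Gs1.map Atom.pred) l2

/-- The clauses of the residual program. -/
inductive ResClause {L : FirstOrder.Language.{u, v}} {Pred : Type w} {ar : Pred → ℕ}
    (Q : Set (Clause L ar ℕ)) (goal : Pred) (hgoal : ar goal = 0) (Index : ℤ) :
    Clause L (resArity ar) ResVar → Prop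
  /-- From the clause `go(Index) :- solve([false], Index, 1)`. -/
  | go : ResClause Q goal hgoal Index
      ⟨Atom.prop (.go Index) rfl, ⊤, [solveAtom [Atom.prop goal hgoal] Index 1]⟩
  /-- From the clause for `solve([G|Gs], Index, L)`. -/
  | step (p : Pred) (ps : List Pred) (l : ℤ) (G : Atom ar ResVar) (Cs : L.Formula ResVar)
      (Gs1 : List (Atom ar ResVar)) (l2 : ℤ)
      (hcall : Called Q goal Index (p :: ps) l)
      (hres : Resultant Q Index p ps l G Cs Gs1 l2) :
      ResClause Q goal hgoal Index
        ⟨solveAtom (G :: freshAtoms ar ps) Index l, Cs, [solveAtom Gs1 Index l2]⟩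
  /-- From the clause `solve([], _, _)`. -/
  | nil (l : ℤ) (hcall : Called Q goal Index [] l) :
      ResClause Q goal hgoal Index ⟨solveAtom [] Index l, ⊤, []⟩

/-- The partial evaluation of the interpreter with respect to the object program `Q`, whose
top-level predicate symbol is `goal`, and the call `go(Index)`. -/
def partialEval {L : FirstOrder.Language.{u, v}} {Pred : Type w} {ar : Pred → ℕ}
    (Q : Set (Clause L ar ℕ)) (goal : Pred) (hgoal : ar goal = 0) (Index : ℤ) :
    Set (Clause L (resArity ar) ResVar) :=
  {c | ResClause Q goal hgoal Index c}

end CHC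

/-!
Both directions are proved inside a fixed model `M` of the constraint theory, by turning an
interpretation of one program into an interpretation of the other; no derivations are needed.

*Soundness.* From a model `I` of the object program, interpret a specialised predicate
`solve [p₁, …, pₙ]` as "all of `p₁(a₁), …, pₙ(aₙ)` hold in `I`" (`AllHold`). This makes
every residual clause true (`trueIn_of_mem_partialEval`), for any object program.

*Completeness.* From a model `R` of the residual program, interpret an object predicate `q` as
`Solvable R … q a m`: whenever a goal list with head `q` is called at level `l` with
`l + m ≤ Index`, the tail of the list is called at level `l - 1`, and truth of `solve` for the tail
(in `R`) implies truth of `solve` for the whole list. Reachability of the tail has to be part of this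
notion because residual clauses exist only for reachable call patterns. The slack `m` is
`(i - 1) * d` for a predicate of dimension (at most) `d`. The clauses of the bounded program hold
because the body can be permuted so that the atom of dimension `d`, if there is one, is solved
last: the atoms before it have dimension at most `d - 1` and are solved at level at most
`l + i - 1`, and `(l + i - 1) + (i - 1) * (d - 1) = l + (i - 1) * d`; at the last atom the
level is back to `l`. The lemma `solvable_head` carries the unfolding step, and
`reduces_of_forall_solvable` and `Reduces.append` the processing of a body.
-/

namespace CHC

/-! ### Argument tuples of lists of atoms -/

section Flatten

variable {Pred : Type w} {ar : Pred → ℕ} {V : Type} {M : Type*}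

theorem comp_flatten_cons (val : V → M) (A : Atom ar V) (Gs : List (Atom ar V)) :
    val ∘ flatten (A :: Gs) = Fin.append (val ∘ A.args) (val ∘ flatten Gs) := by
  funext x
  refine Fin.addCases (fun j => ?_) (fun j => ?_) x
  · exact (congrArg val (Fin.append_left A.args (flatten Gs) j)).trans
      (Fin.append_left (val ∘ A.args) (val ∘ flatten Gs) j).symm
  · exact (congrArg val (Fin.append_right A.args (flatten Gs) j)).trans
      (Fin.append_right (val ∘ A.args) (val ∘ flatten Gs) j).symm

/-- Every argument tuple of a specialised predicate is the value of the flattened list of fresh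
atoms under some assignment `w` of the fresh variables. The offset `n` makes the
statement inductive. -/
theorem exists_assignment [Nonempty M] (ps : List Pred) (f : Fin ((ps.map ar).sum) → M) :
    ∃ w : ℕ → ℕ → M, ∀ (n : ℕ) (val : ResVar → M),
      (∀ i j, val (.inr (i + n, j)) = w i j) → ∀ Gs : List (Atom ar ResVar),
      Gs = (ps.mapIdx fun i p => ⟨p, fun j => .inr (i + n, (j : ℕ))⟩) →
      (⟨Gs.map Atom.pred, val ∘ flatten Gs⟩ : Σ qs : List Pred, (Fin ((qs.map ar).sum) → M)) =
        ⟨ps, f⟩ := by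
  induction ps with
  | nil =>
    refine ⟨fun _ _ => Classical.arbitrary M, fun n val _ Gs hGs => ?_⟩
    subst hGs
    simp only [List.mapIdx_nil]
    congr 1
    funext x
    exact x.elim0
  | cons p ps ih =>
    obtain ⟨w, hw⟩ := ih fun j => f (Fin.natAdd (ar p) j)
    refine ⟨fun i j => Nat.casesOn i
      (if h : j < ar p then f (Fin.castAdd ((ps.map ar).sum) ⟨j, h⟩) else Classical.arbitrary M)
      (fun i => w i j), fun n val hval Gs hGs => ?_⟩
    rw [List.mapIdx_cons] at hGs
    subst hGs
    have htail := hw (n + 1) val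
      (fun i j => by simpa only [Nat.add_assoc, Nat.add_comm 1 n] using hval (i + 1) j) _ rfl
    have hfun : (fun i (p : Pred) => (⟨p, fun j => .inr (i + 1 + n, (j : ℕ))⟩ : Atom ar ResVar)) =
        fun i p => ⟨p, fun j => .inr (i + (n + 1), (j : ℕ))⟩ := by
      funext i p
      rw [Nat.add_assoc, Nat.add_comm 1 n]
    rw [hfun, comp_flatten_cons]
    -- Prepending an argument tuple is a function of the pair (predicates, arguments).
    have hcons := congrArg
      (fun s : Σ qs : List Pred, (Fin ((qs.map ar).sum) → M) =>
        (⟨p :: s.1, Fin.append (fun j => f (Fin.castAdd ((ps.map ar).sum) j)) s.2⟩ :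
          Σ qs : List Pred, (Fin ((qs.map ar).sum) → M))) htail
    refine Eq.trans ?_ (hcons.trans ?_)
    · have hhead : (val ∘ fun j : Fin (ar p) => (.inr (0 + n, (j : ℕ)) : ResVar)) =
          fun j => f (Fin.castAdd ((ps.map ar).sum) j) := by
        funext j
        exact (hval 0 j).trans (by simp)
      exact congrArg (fun a => (⟨p :: _, Fin.append a _⟩ :
          Σ qs : List Pred, (Fin ((qs.map ar).sum) → M))) hhead
    · exact congrArg (Sigma.mk (β := fun qs : List Pred => Fin ((qs.map ar).sum) → M) (p :: ps))
        (Fin.append_castAdd_natAdd (f := f))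

/-- A valuation of the object variables and an argument tuple for the remaining goals have a
common extension to the variables of a residual clause. -/
theorem exists_valuation [Nonempty M] (ps : List Pred) (f : Fin ((ps.map ar).sum) → M)
    (val : ℕ → M) :
    ∃ val' : ResVar → M, val' ∘ Sum.inl = val ∧
      (⟨(freshAtoms ar ps).map Atom.pred, val' ∘ flatten (freshAtoms ar ps)⟩ :
        Σ qs : List Pred, (Fin ((qs.map ar).sum) → M)) = ⟨ps, f⟩ := by
  obtain ⟨w, hw⟩ := exists_assignment ps f
  exact ⟨Sum.elim val fun x => w x.1 x.2, rfl, hw 0 _ (fun _ _ => rfl) _ rfl⟩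

theorem map_pred_freshAtoms (ps : List Pred) : (freshAtoms ar ps).map Atom.pred = ps := by
  refine List.ext_getElem ?_ fun _ _ _ => ?_ <;> simp [freshAtoms]

end Flatten

/-! ### Soundness of the partial evaluation -/

section Soundness

variable {L : FirstOrder.Language.{u, v}} {Pred : Type w} {ar : Pred → ℕ} {V : Type} {M : Type*}

/-- All atoms with predicates `ps` hold in `I`, where the argument tuple is the concatenation of the
argument tuples of the atoms. -/
def AllHold (I : Interp ar M) : (ps : List Pred) → (Fin ((ps.map ar).sum) → M) → Prop
  | [], _ => True
  | p :: ps, f => I p (fun j => f (Fin.castAdd ((ps.map ar).sum) j)) ∧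
      AllHold I ps (fun j => f (Fin.natAdd (ar p) j))

theorem allHold_flatten (I : Interp ar M) (val : V → M) (Gs : List (Atom ar V)) :
    AllHold I (Gs.map Atom.pred) (val ∘ flatten Gs) ↔ ∀ G ∈ Gs, G.Holds I val := by
  induction Gs with
  | nil => exact iff_of_true trivial (by simp)
  | cons G Gs ih =>
    rw [List.forall_mem_cons, ← ih]
    refine and_congr (iff_of_eq (congrArg (I G.pred) ?_))
      (iff_of_eq (congrArg (AllHold I (Gs.map Atom.pred)) ?_)) <;> funext j
    · exact congrArg val (Fin.append_left G.args (flatten Gs) j)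
    · exact congrArg val (Fin.append_right G.args (flatten Gs) j)

/-- The interpretation of the residual predicates that is induced by one of the object
predicates. -/
def residualInterp (I : Interp ar M) (goal : Pred) (hgoal : ar goal = 0) :
    Interp (resArity ar) M
  | .go _, _ => I goal fun j => (Fin.cast hgoal j).elim0
  | .solve ps _ _, f => AllHold I ps f

theorem trueIn_of_mem_partialEval [L.Structure M] {Q : Set (Clause L ar ℕ)} {I : Interp ar M}
    (hI : ∀ c ∈ Q, c.TrueIn I) (goal : Pred) (hgoal : ar goal = 0) (Index : ℤ)
    {c : Clause L (resArity ar) ResVar} (hc : c ∈ partialEval Q goal hgoal Index) :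
    c.TrueIn (residualInterp I goal hgoal) := by
  intro val hcon hbody
  cases hc with
  | go =>
    have h := (allHold_flatten I val _).1 (hbody _ (List.mem_singleton_self _)) _
      (List.mem_singleton_self _)
    refine (congrArg (I goal) (funext fun j => ?_)).mp h
    exact (Fin.cast hgoal j).elim0
  | step p ps l G Cs Gs1 l2 hcall hres =>
    have h := (allHold_flatten I val _).1 (hbody _ (List.mem_singleton_self _))
    refine (allHold_flatten I val _).2 ?_
    obtain ⟨-, hstep⟩ := hres
    cases hstep with
    | intro _ _ _ _ B B1 _ L1 _ hclause hlength his hle hperm happend =>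
      subst happend
      obtain ⟨c, hcQ, rfl, rfl, rfl⟩ := hclause
      rw [List.forall_mem_append] at h
      refine List.forall_mem_cons.2 ⟨?_, h.2⟩
      refine hI c hcQ (val ∘ Sum.inl) (FirstOrder.Language.Formula.realize_relabel.1 hcon) ?_
      intro A hA
      exact h.1 _ (hperm.mem_iff.1 (List.mem_map_of_mem hA))
  | nil l hcall => trivial

end Soundness

/-! ### Completeness of the partial evaluation -/

section Completeness

variable {L : FirstOrder.Language.{u, v}} {Pred : Type w} {ar : Pred → ℕ} {V : Type} {M : Type*}

/-- In the interpretation `R` of the residual predicates, the goal `q(a)` can be solved with slack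
`m` on top of any goal list: if a list with head `q` is called at level `l` and `l + m ≤ Index`, then
its tail is called at level `l - 1`, and `solve` holds for the list with head `q(a)` if it holds
for the tail. -/
def Solvable (R : Interp (resArity ar) M) (Q : Set (Clause L ar ℕ)) (goal : Pred) (Index : ℤ)
    (q : Pred) (a : Fin (ar q) → M) (m : ℤ) : Prop :=
  ∀ (ps : List Pred) (f : Fin ((ps.map ar).sum) → M) (l : ℤ), l + m ≤ Index →
    Called Q goal Index (q :: ps) l →
    Called Q goal Index ps (l - 1) ∧
      (R (.solve ps Index (l - 1)) f → R (.solve (q :: ps) Index l) (Fin.append a f))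

/-- The analogue of `Solvable` for a list of atoms on top of a goal list `Gs`. Here `l` is the
level at which a single atom on top of `Gs` would be called. -/
def Reduces (R : Interp (resArity ar) M) (Q : Set (Clause L ar ℕ)) (goal : Pred) (Index : ℤ)
    (val : V → M) (B : List (Atom ar V)) (m : ℤ) : Prop :=
  ∀ (Gs : List (Atom ar V)) (l : ℤ), l + m ≤ Index →
    Called Q goal Index ((B ++ Gs).map Atom.pred) (l + B.length - 1) →
    Called Q goal Index (Gs.map Atom.pred) (l - 1) ∧
      ((solveAtom Gs Index (l - 1)).Holds R val →
        (solveAtom (B ++ Gs) Index (l + B.length - 1)).Holds R val)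

variable {R : Interp (resArity ar) M} {Q : Set (Clause L ar ℕ)} {goal : Pred} {Index : ℤ}

theorem Solvable.mono {q : Pred} {a : Fin (ar q) → M} {m m' : ℤ}
    (h : Solvable R Q goal Index q a m) (hm : m ≤ m') : Solvable R Q goal Index q a m' :=
  fun ps f l hl => h ps f l (by omega)

theorem reduces_singleton {val : V → M} {A : Atom ar V} {m : ℤ}
    (h : Solvable R Q goal Index A.pred (val ∘ A.args) m) :
    Reduces R Q goal Index val [A] m := by
  intro Gs l hl hcall
  simp only [List.length_singleton, Nat.cast_one, add_sub_cancel_right] at hcall ⊢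
  obtain ⟨h₁, h₂⟩ := h (Gs.map Atom.pred) (val ∘ flatten Gs) l hl hcall
  refine ⟨h₁, fun hs => ?_⟩
  exact (congrArg (R (.solve (A.pred :: Gs.map Atom.pred) Index l))
    (comp_flatten_cons val A Gs)).mpr (h₂ hs)

/-- Solving `B₁` before `B₂` needs additional slack for the atoms of `B₂` waiting below. -/
theorem Reduces.append {val : V → M} {B₁ B₂ : List (Atom ar V)} {m₁ m₂ m : ℤ}
    (h₁ : Reduces R Q goal Index val B₁ m₁) (h₂ : Reduces R Q goal Index val B₂ m₂)
    (hm₁ : B₂.length + m₁ ≤ m) (hm₂ : m₂ ≤ m) :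
    Reduces R Q goal Index val (B₁ ++ B₂) m := by
  intro Gs l hl hcall
  have e₁ : l + ((B₁ ++ B₂).length : ℤ) - 1 = l + B₂.length + B₁.length - 1 := by
    rw [List.length_append]
    push_cast
    ring
  rw [e₁, List.append_assoc] at hcall ⊢
  obtain ⟨c₁, t₁⟩ := h₁ (B₂ ++ Gs) (l + B₂.length) (by omega) hcall
  obtain ⟨c₂, t₂⟩ := h₂ Gs l (by omega) c₁
  exact ⟨c₂, fun h => t₁ (t₂ h)⟩

theorem reduces_nil (val : V → M) (m : ℤ) : Reduces R Q goal Index val [] m := by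
  intro Gs l _ hcall
  simp only [List.nil_append, List.length_nil, Nat.cast_zero, add_zero] at hcall ⊢
  exact ⟨hcall, id⟩

theorem reduces_of_forall_solvable {val : V → M} {m : ℤ} (B : List (Atom ar V))
    (h : ∀ A ∈ B, Solvable R Q goal Index A.pred (val ∘ A.args) m) :
    Reduces R Q goal Index val B (B.length - 1 + m) := by
  induction B with
  | nil => exact reduces_nil val _
  | cons A B ih =>
    rw [List.forall_mem_cons] at h
    exact (reduces_singleton h.1).append (ih h.2) (by simp) (by simp [sub_eq_add_neg])

/-- The unfolding step: the head of a true instance of an object clause is solvable if the body, in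
some order, can be processed. -/
theorem solvable_head [L.Structure M] [Nonempty M] {hgoal : ar goal = 0}
    (hR : ∀ c ∈ partialEval Q goal hgoal Index, c.TrueIn R) {c : Clause L ar ℕ} (hc : c ∈ Q)
    {val : ℕ → M} (hcon : c.constr.Realize val) {B : List (Atom ar ℕ)} (hB : c.body.Perm B)
    {m : ℤ} (hm : (c.body.length : ℤ) - 1 ≤ m)
    (hred : ∀ val' : ResVar → M, val' ∘ Sum.inl = val →
      Reduces R Q goal Index val' (B.map (Atom.rename Sum.inl)) m) :
    Solvable R Q goal Index c.head.pred (val ∘ c.head.args) m := by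
  intro ps f l hl hcall
  obtain ⟨val', rfl, hf⟩ := exists_valuation ps f val
  have hres : Resultant Q Index c.head.pred ps l (c.head.rename Sum.inl)
      (c.constr.relabel Sum.inl) (B.map (Atom.rename Sum.inl) ++ freshAtoms ar ps)
      (l + (B.map (Atom.rename (Sum.inl : ℕ → ResVar))).length - 1) := by
    refine ⟨rfl, .intro _ _ _ _ (c.body.map (Atom.rename Sum.inl)) _ _ _ _
      ⟨c, hc, rfl, rfl, rfl⟩ rfl ?_ ?_ (hB.map _) rfl⟩
    · simp only [List.length_map, hB.length_eq]
      ring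
    · simp only [List.length_map, ← hB.length_eq]
      omega
  obtain ⟨h₁, h₂⟩ := hred val' rfl (freshAtoms ar ps) l hl (.step _ _ _ _ _ _ _ hcall hres)
  rw [map_pred_freshAtoms] at h₁
  refine ⟨h₁, fun hs => ?_⟩
  have hs' : (solveAtom (freshAtoms ar ps) Index (l - 1)).Holds R val' :=
    (congrArg (fun s : Σ qs : List Pred, (Fin ((qs.map ar).sum) → M) =>
      R (.solve s.1 Index (l - 1)) s.2) hf).mpr hs
  have ht := hR _ (ResClause.step _ _ _ _ _ _ _ hcall hres) val'
    (FirstOrder.Language.Formula.realize_relabel.2 hcon)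
    (fun A hA => by rw [List.mem_singleton.1 hA]; exact h₂ hs')
  replace ht := (congrArg
    (R (.solve (c.head.pred :: (freshAtoms ar ps).map Atom.pred) Index l))
    (comp_flatten_cons val' (c.head.rename Sum.inl) (freshAtoms ar ps))).mp ht
  exact (congrArg (fun s : Σ qs : List Pred, (Fin ((qs.map ar).sum) → M) =>
      R (.solve (c.head.pred :: s.1) Index l)
        (Fin.append ((val' ∘ Sum.inl) ∘ c.head.args) s.2)) hf).mp ht

/-- If `goal` is solvable within the bound `Index`, then the residual program proves
`go(Index)`. -/
theorem go_of_solvable [L.Structure M] [Nonempty M] {hgoal : ar goal = 0}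
    (hR : ∀ c ∈ partialEval Q goal hgoal Index, c.TrueIn R) {m : ℤ} (hm : 1 + m ≤ Index)
    (h : ∀ val : ResVar → M, (Atom.prop goal hgoal).Holds
      (fun q a => Solvable R Q goal Index q a m) val) (val : ResVar → M) :
    (Atom.prop (ar := resArity ar) (.go Index) rfl).Holds R val := by
  obtain ⟨hnil, hsolve⟩ := reduces_singleton (h val) [] 1 hm .init
  refine hR _ .go val (FirstOrder.Language.Formula.realize_top.2 trivial) fun A hA => ?_
  rw [List.mem_singleton.1 hA]
  exact hsolve (hR _ (.nil _ hnil) val (FirstOrder.Language.Formula.realize_top.2 trivial) (by simp))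

/-- A body that can be ordered so that its last atom has slack `m` and the other ones have slack
`m₀` leads to a head with slack `m`, provided the other atoms fit into the bound. -/
theorem solvable_of_body [L.Structure M] [Nonempty M] {hgoal : ar goal = 0}
    (hR : ∀ c ∈ partialEval Q goal hgoal Index, c.TrueIn R) {c : Clause L ar ℕ} (hc : c ∈ Q)
    {val : ℕ → M} (hcon : c.constr.Realize val) {B : List (Atom ar ℕ)} {A : Atom ar ℕ}
    (hB : c.body.Perm (B ++ [A])) {m₀ m : ℤ} (hm₀ : B.length + m₀ ≤ m) (hm : B.length ≤ m)
    (h : ∀ A ∈ B, Solvable R Q goal Index A.pred (val ∘ A.args) m₀)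
    (hA : Solvable R Q goal Index A.pred (val ∘ A.args) m) :
    Solvable R Q goal Index c.head.pred (val ∘ c.head.args) m := by
  refine solvable_head hR hc hcon hB (by simp [hB.length_eq, hm]) fun val' hval' => ?_
  subst hval'
  rw [List.map_append]
  refine (reduces_of_forall_solvable (m := m₀) _ ?_).append
    (reduces_singleton (A := A.rename Sum.inl) hA) ?_ le_rfl
  · intro A' hA'
    obtain ⟨A, hAB, rfl⟩ := List.mem_map.1 hA'
    exact h A hAB
  · simp only [List.length_map, List.length_singleton]
    push_cast
    omega

end Completeness

/-! ### The dimension-bounded program -/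

section Bounded

variable {L : FirstOrder.Language.{u, v}} {Pred : Type w} {ar : Pred → ℕ} {M : Type*}

/-- The dimension bound given by a superscript. -/
def DimTag.bound : DimTag → ℕ
  | .exactly d => d
  | .atMost d => d

/-- The interpretation of the split predicate symbols in which an atom of dimension bound `d` is
true if it is solvable with slack `(i - 1) * d`. -/
def solvableInterp (R : Interp (resArity (dimArity ar)) M) (Q : Set (Clause L (dimArity ar) ℕ))
    (goal : Pred × DimTag) (Index : ℤ) (i : ℕ) : Interp (dimArity ar) M :=
  fun q a => Solvable R Q goal Index q a (((i : ℤ) - 1) * q.2.bound)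

variable {R : Interp (resArity (dimArity ar)) M} {Q : Set (Clause L (dimArity ar) ℕ)}
  {goal : Pred × DimTag} {hgoal : dimArity ar goal = 0} {Index : ℤ} {i : ℕ}

/-- Truth of an annotated clause with head dimension `d` in which every body atom except the `j`-th
one has a dimension bound less than `d`: the body is permuted so that the `j`-th atom is solved
last. This covers all clauses with a nonempty body that come from clauses of the given program. -/
theorem annotate_trueIn [L.Structure M] [Nonempty M]
    (hR : ∀ c ∈ partialEval Q goal hgoal Index, c.TrueIn R) (c : Clause L ar ℕ)
    (hlen : c.body.length ≤ i) (d : ℕ) (z : Fin c.body.length → DimTag)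
    (hc : c.annotate d z ∈ Q) (j : Fin c.body.length) (hj : (z j).bound ≤ d)
    (hz : ∀ j', j' ≠ j → (z j').bound + 1 ≤ d) :
    (c.annotate d z).TrueIn (solvableInterp R Q goal Index i) := by
  intro val hcon hbody
  have hi : (0 : ℤ) ≤ (i : ℤ) - 1 := by
    have := j.pos
    omega
  have hlen' : (c.annotate d z).body.length = c.body.length := List.length_ofFn
  have hj' : (j : ℕ) < (c.annotate d z).body.length := by
    rw [hlen']
    exact j.isLt
  have hB : ((((c.annotate d z).body.eraseIdx j).length : ℕ) : ℤ) = c.body.length - 1 := by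
    rw [List.length_eraseIdx_of_lt hj', hlen']
    have := j.pos
    omega
  have hget : (c.annotate d z).body[(j : ℕ)] = (c.body.get j).tag (z j) := by
    simp [Clause.annotate]
  refine solvable_of_body hR hc hcon (B := (c.annotate d z).body.eraseIdx j)
    (A := (c.body.get j).tag (z j)) (m₀ := ((i : ℤ) - 1) * (d - 1)) ?_ ?_ ?_ ?_ ?_
  · rw [← hget]
    exact (List.getElem_cons_eraseIdx_perm hj').symm.trans (List.perm_append_singleton _ _).symm
  · rw [hB]
    change _ ≤ ((i : ℤ) - 1) * (d : ℤ)
    rw [mul_sub, mul_one]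
    omega
  · rw [hB]
    change _ ≤ ((i : ℤ) - 1) * (d : ℤ)
    -- If `d = 0` then the `j`-th atom is the only one.
    rcases Nat.eq_zero_or_pos d with rfl | hd
    · have : c.body.length ≤ 1 := by
        by_contra hlt
        have : Nontrivial (Fin c.body.length) := Fin.nontrivial_iff_two_le.2 (by omega)
        obtain ⟨j', hne⟩ := exists_ne j
        exact absurd (hz j' hne) (by omega)
      simp only [Nat.cast_zero, mul_zero]
      omega
    · have : (1 : ℤ) ≤ d := by exact_mod_cast hd
      nlinarith
  · intro A hA
    obtain ⟨n, hn, hne, rfl⟩ := List.mem_eraseIdx_iff_getElem.1 hA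
    have hn' : n < c.body.length := by
      rwa [hlen'] at hn
    have hget' : (c.annotate d z).body[n] = (c.body.get ⟨n, hn'⟩).tag (z ⟨n, hn'⟩) := by
      simp [Clause.annotate]
    have hs := hbody _ (List.getElem_mem hn)
    rw [hget'] at hs ⊢
    refine Solvable.mono hs (mul_le_mul_of_nonneg_left ?_ hi)
    have := hz ⟨n, hn'⟩ fun h => hne (congrArg Fin.val h)
    change ((z ⟨n, hn'⟩).bound : ℤ) ≤ _
    omega
  · have hs := hbody _ (List.getElem_mem hj')
    rw [hget] at hs
    exact Solvable.mono hs (mul_le_mul_of_nonneg_left (Int.ofNat_le.2 hj) hi)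

theorem trueIn_of_mem_boundedProgram [L.Structure M] [Nonempty M] {P : Set (Clause L ar ℕ)} {k : ℕ}
    (hi : ∀ c ∈ P, c.body.length ≤ i) (hik : 1 ≤ i ∨ k = 0)
    (hR : ∀ c ∈ partialEval (boundedProgram P k) goal hgoal Index, c.TrueIn R)
    {c : Clause L (dimArity ar) ℕ} (hc : c ∈ boundedProgram P k) :
    c.TrueIn (solvableInterp R (boundedProgram P k) goal Index i) := by
  have hmem : c ∈ boundedProgram P k := hc
  cases hc with
  | fact c hc hr z =>
    intro val hcon _
    have hnil : (c.annotate 0 z).body = [] := List.eq_nil_of_length_eq_zero (by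
      simp [Clause.annotate, hr])
    refine solvable_head hR hmem hcon (B := []) (by rw [hnil]) ?_ fun val' _ => reduces_nil val' _
    simp [hr, Clause.annotate, Atom.tag, DimTag.bound]
  | linear c hc hr d hd =>
    refine annotate_trueIn hR c (hi c hc) d _ hmem ⟨0, by omega⟩ le_rfl fun j' hj' => ?_
    exact absurd (Fin.ext (by have := j'.isLt; simp only; omega)) hj'
  | oneMax c hc hr d hd hdk j =>
    refine annotate_trueIn hR c (hi c hc) d _ hmem j (by simp [DimTag.bound]) fun j' hj' => ?_
    simp only [if_neg hj', DimTag.bound]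
    omega
  | twoMax c hc hr d hd hdk J hJ hdef =>
    have hz : ∀ j, (if j ∈ J then DimTag.exactly (d - 1) else .atMost (d - 1)).bound = d - 1 := by
      intro j
      split <;> rfl
    refine annotate_trueIn hR c (hi c hc) d _ hmem ⟨0, by omega⟩ ?_ fun j' _ => ?_
    · rw [hz]
      omega
    · rw [hz]
      omega
  | eps p d e hdk hed =>
    intro val hcon hbody
    -- The slack is monotone in the dimension unless `i = 0`, and in that case `k = 0`.
    have hle : ((i : ℤ) - 1) * (e : ℤ) ≤ ((i : ℤ) - 1) * (d : ℤ) ∧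
        0 ≤ ((i : ℤ) - 1) * (d : ℤ) := by
      rcases hik with h | rfl
      · have h' : (0 : ℤ) ≤ (i : ℤ) - 1 := by omega
        exact ⟨mul_le_mul_of_nonneg_left (Int.ofNat_le.2 hed) h', by positivity⟩
      · obtain rfl : d = 0 := by omega
        obtain rfl : e = 0 := by omega
        simp
    exact solvable_of_body hR hmem hcon (B := [])
      (m₀ := ((i : ℤ) - 1) * (d : ℤ)) (.refl _) (by simp [epsClause, DimTag.bound])
      (by simpa [epsClause, DimTag.bound] using hle.2) (by simp)
      (Solvable.mono (hbody _ (List.mem_singleton_self _)) hle.1)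

end Bounded

theorem isLinear_partialEval {L : FirstOrder.Language.{u, v}} {Pred : Type w} {ar : Pred → ℕ}
    (Q : Set (Clause L ar ℕ)) (goal : Pred) (hgoal : ar goal = 0) (Index : ℤ) :
    IsLinear (partialEval Q goal hgoal Index) := by
  intro c hc
  cases hc <;> simp

end CHC

theorem proposition2 {L : FirstOrder.Language.{u, v}} (T : L.Theory)
    {Pred : Type w} (ar : Pred → ℕ) (fls : Pred) (hfls : ar fls = 0)
    (P : Set (CHC.Clause L ar ℕ)) (k i : ℕ)
    (hi : IsGreatest ((fun c : CHC.Clause L ar ℕ => c.body.length) '' P) i)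
    (hik : 1 ≤ i ∨ k = 0)
    (Index : ℤ) (hIndex : Index = ((i : ℤ) - 1) * (k : ℤ) + 1)
    (P' : Set (CHC.Clause L (CHC.resArity (CHC.dimArity ar)) CHC.ResVar))
    (hP' : P' = CHC.partialEval (CHC.boundedProgram P k) (fls, .atMost k) hfls Index) :
    (CHC.Entails T (CHC.boundedProgram P k) (CHC.Atom.prop (fls, .atMost k) hfls) ↔
      CHC.Entails T P' (CHC.Atom.prop (.go Index) rfl)) ∧
    CHC.IsLinear P' := by
  subst hP'
  refine ⟨⟨fun h M R hR val => ?_, fun h M I hI val => ?_⟩, CHC.isLinear_partialEval _ _ _ _⟩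
  · refine CHC.go_of_solvable (m := ((i : ℤ) - 1) * (k : ℤ)) hR (by omega) (fun val' => ?_) val
    have hs := h M _ (fun c hc => CHC.trueIn_of_mem_boundedProgram
      (fun c hc => hi.2 ⟨c, hc, rfl⟩) hik hR hc) fun _ => Classical.arbitrary M
    refine (congrArg (fun a => CHC.Solvable R _ _ Index (fls, .atMost k) a
      (((i : ℤ) - 1) * (k : ℤ))) (funext fun j => ?_)).mp hs
    exact (Fin.cast hfls j).elim0
  · have hg := h M _ (fun c hc => CHC.trueIn_of_mem_partialEval hI (fls, .atMost k) hfls Index hc)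
      fun _ => Classical.arbitrary M
    refine (congrArg (I (fls, .atMost k)) (funext fun j => ?_)).mp hg
    exact (Fin.cast hfls j).elim0
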